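/- A real entire function is an entire function $\varphi$ that is real on the real line; write $\varphi(x)=\sum_{k=0}^{\infty}\frac{\gamma_k}{k!}x^k$ with $\gamma_k=\varphi^{(k)}(0)\in\mathbb{R}$. Let $\mathscr{L}-\mathscr{P}^+$ be the class of real entire functions $\varphi$ with $\gamma_k\ge 0$ for all $k\ge 0$ such that at least one of $\psi(x)=\varphi(x)$, $\psi(x)=\varphi(-x)$ admits a representation $$\psi(x)=c\,x^m e^{\sigma x}\prod_{k=1}^{\omega}\left(1+\frac{x}{x_k}\right),$$ where $c\in\mathbb{R}$, $m$ is a non-negative integer, $\sigma\ge 0$, $0\le\omega\le\infty$, $x_k>0$ and $\sum_{k=1}^{\omega}\frac{1}{x_k}<\infty$. A sequence of real numbers $\{\alpha_k\}_{k=0}^{\infty}$ is called a multiplier sequence if the linear operator $T$ on $\mathbb{R}[x]$ defined by $T[x^k]=\alpha_k x^k$ $(k=0,1,2,\ldots)$ has the property that, for every real polynomial $p$ without non-real zeros, $T[p]$ has no non-real zeros (the zero polynomial being regarded as having no non-real zeros). For $\varphi(x)=\sum_{k=0}^{\infty}\frac{\gamma_k}{k!}x^k\in\mathscr{L}-\mathscr{P}^+$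 and $t\in[0,1]$ put $$B_k^{\varphi}(t)=\sum_{j=0}^{k}\binom{k}{j}(1-t)^j\,\gamma_{k-j}\,t^{k-j}\qquad(k=0,1,2,\ldots),$$ with the convention $0^0=1$. **Corollary.** Let $\varphi,\Phi\in\mathscr{L}-\mathscr{P}^+$. Then for all $(t,s)\in[0,1]\times[0,1]$ the sequence $$C_k^{\varphi,\Phi}(t,s)=\sum_{j=0}^{k}\binom{k}{j}B_j^{\varphi}(t)\,B_{k-j}^{\Phi}(s)\qquad(k=0,1,2,\ldots)$$ is a multiplier sequence, and for all $x\in\mathbb{C}$ $$e^{((1-t)+(1-s))x}\,\varphi(xt)\,\Phi(xs)=\sum_{k=0}^{\infty}\frac{C_k^{\varphi,\Phi}(t,s)}{k!}x^k .$$ -/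

import Mathlib

namespace LaguerrePolya

open Polynomial

/-- A real entire function: entire, and real-valued on the real line. -/
def IsRealEntire (φ : ℂ → ℂ) : Prop :=
  Differentiable ℂ φ ∧ ∀ x : ℝ, (φ (x : ℂ)).im = 0

/-- The numbers `γ k` in the expansion `φ x = ∑ γ k / k! * x ^ k` of a real entire function,
that is, `γ k = φ⁽ᵏ⁾(0)` (which is real for such a function). -/
noncomputable def taylorCoeff (φ : ℂ → ℂ) (k : ℕ) : ℝ :=
  (iteratedDeriv k φ 0).re

/-- The representation `φ z = c z ^ m e ^ (σ z) ∏ (1 + z / x k)`, the product having `ω` factors,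
`0 ≤ ω ≤ ∞`, indexed by the natural numbers `k < ω`. As `∑ 1 / x k` is finite, the product
converges unconditionally. -/
def HasTypeIRepresentation (φ : ℂ → ℂ) : Prop :=
  ∃ (c : ℝ) (m : ℕ) (σ : ℝ) (ω : ℕ∞) (x : {k : ℕ // (k : ℕ∞) < ω} → ℝ),
    0 ≤ σ ∧ (∀ k, 0 < x k) ∧ Summable (fun k => 1 / x k) ∧
    ∀ z : ℂ, φ z = (c : ℂ) * z ^ m * Complex.exp ((σ : ℂ) * z) * ∏' k, (1 + z / (x k : ℂ))

/-- The functions of type I in the Laguerre–Pólya class. -/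
def IsTypeI (φ : ℂ → ℂ) : Prop :=
  IsRealEntire φ ∧ (HasTypeIRepresentation φ ∨ HasTypeIRepresentation (fun z => φ (-z)))

/-- The class of functions of type I with nonnegative Taylor coefficients. -/
def IsLPPlus (φ : ℂ → ℂ) : Prop :=
  IsTypeI φ ∧ ∀ k, 0 ≤ taylorCoeff φ k

/-- The linear operator `T` on real polynomials with `T[x ^ k] = γ k * x ^ k`. -/
noncomputable def diagonalOperator (γ : ℕ → ℝ) : ℝ[X] →ₗ[ℝ] ℝ[X] :=
  (Polynomial.basisMonomials ℝ).constr ℝ (fun k => γ k • (X : ℝ[X]) ^ k)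

theorem diagonalOperator_X_pow (γ : ℕ → ℝ) (k : ℕ) :
    diagonalOperator γ (X ^ k) = γ k • (X : ℝ[X]) ^ k := by
  have h := (Polynomial.basisMonomials ℝ).constr_basis ℝ (fun k => γ k • (X : ℝ[X]) ^ k) k
  simpa only [diagonalOperator, Polynomial.coe_basisMonomials,
    Polynomial.monomial_one_right_eq_X_pow] using h

open Classical in
/-- The number of nonreal zeros of a real polynomial, counted with multiplicity
(`0` for the zero polynomial). -/
noncomputable def numNonrealZeros (p : ℝ[X]) : ℕ :=
  Multiset.card ((p.map (algebraMap ℝ ℂ)).roots.filter (fun z => z.im ≠ 0))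

/-- (Classical) multiplier sequences. -/
def IsMultiplierSequence (γ : ℕ → ℝ) : Prop :=
  ∀ p : ℝ[X], numNonrealZeros p = 0 → numNonrealZeros (diagonalOperator γ p) = 0

/-- `B k (t) = ∑_{j ≤ k} (k choose j) (1 - t) ^ j γ_{k - j} t ^ (k - j)`, where the `γ k` are
the Taylor coefficients of `φ`. -/
noncomputable def seqB (φ : ℂ → ℂ) (t : ℝ) (k : ℕ) : ℝ :=
  ∑ j ∈ Finset.range (k + 1),
    (k.choose j : ℝ) * (1 - t) ^ j * taylorCoeff φ (k - j) * t ^ (k - j)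

/-- `C k (t, s) = ∑_{j ≤ k} (k choose j) B^φ_j(t) B^Φ_{k - j}(s)`. -/
noncomputable def seqC (φ Φ : ℂ → ℂ) (t s : ℝ) (k : ℕ) : ℝ :=
  ∑ j ∈ Finset.range (k + 1), (k.choose j : ℝ) * seqB φ t j * seqB Φ s (k - j)

end LaguerrePolya

/-!
Call a complex polynomial *stable* if it has no zeros in the open upper half-plane `H`. For a
function `f` with Taylor coefficients `γ k = f⁽ᵏ⁾(0)`, a point `x` and `D = d/dy`, consider the
operator `f(xD) = ∑ γ k / k! * x ^ k * D ^ k` on polynomials in `y`. Two observations give the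
multiplier property.

* For `x ∈ H` and `f` in the class considered, `f(xD)` preserves stability (or yields `0`). As
  `f ↦ f(xD)` is multiplicative by the Leibniz rule (`scaledDiffOp_mul`), only the factors of the
  product representation matter: `xD` is the Gauss–Lucas theorem (`IsStable.derivative`),
  `1 + αxD` with `α > 0` is a statement on the imaginary part of the logarithmic derivative
  (`IsStable.add_C_mul_derivative`), and `exp (σxD)` is the translation by `σx ∈ H`
  (`eval_scaledDiffOp_exp`). Infinite products follow by Hurwitz's theorem, which for polynomials
  of bounded degree is elementary (`eq_zero_or_isStable_of_tendsto`).
* If `p = ∑ a k * y ^ k`, then the value of `f(xD) p` at `y = 0` is `∑ γ k * a k * x ^ k`, the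
  image of `p` under the diagonal operator of `γ`. Letting `y` tend to `0` in `H` and applying
  Hurwitz's theorem in the variable `x` shows that this image is stable or `0`; being real, it has
  only real zeros (`PreservesStability.isMultiplierSequence`).

If `φ(-z)` instead of `φ(z)` has the product representation, nonnegativity of the Taylor
coefficients makes `φ` a monomial (`IsLPPlus.exists_eq_mul_pow`), so the first point still applies.
Finally, by the Leibniz rule the numbers `C k (t, s)` are the derivatives at `0` of
`e ^ ((1 - t) z) φ(tz) * e ^ ((1 - s) z) Φ(sz)`, a product of functions that preserve stability,
and the power series identity is the Taylor expansion of this entire function.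
-/

namespace LaguerrePolya

open Polynomial Filter Topology

/-- A complex polynomial is *stable* if it has no zeros in the open upper half-plane. -/
def IsStable (p : ℂ[X]) : Prop :=
  ∀ y : ℂ, 0 < y.im → p.eval y ≠ 0

theorem IsStable.ne_zero {p : ℂ[X]} (hp : IsStable p) : p ≠ 0 := by
  rintro rfl
  exact hp Complex.I (by simp) (by simp)

/-! ### Limits of stable polynomials -/

/-- Each factor `w - ρ` of `p` has modulus at most `‖w - z‖ + ‖z - ρ‖ ≤ 2 * ‖z - ρ‖`. -/
theorem norm_eval_le_of_forall_mem_ball_eval_ne_zero {p : ℂ[X]} {z w : ℂ} {r : ℝ} {N : ℕ}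
    (hN : p.natDegree ≤ N) (hp : ∀ y ∈ Metric.ball z r, p.eval y ≠ 0) (hw : w ∈ Metric.ball z r) :
    ‖p.eval w‖ ≤ 2 ^ N * ‖p.eval z‖ := by
  have hs : p.Splits := IsAlgClosed.splits p
  have key : ∀ s : Multiset ℂ, (∀ ρ ∈ s, ρ ∉ Metric.ball z r) →
      ‖(s.map fun ρ => w - ρ).prod‖ ≤ 2 ^ s.card * ‖(s.map fun ρ => z - ρ).prod‖ := by
    intro s
    induction s using Multiset.induction_on with
    | empty => simp
    | cons ρ s ih =>
      intro h
      have h1 := ih fun ρ' hρ' => h ρ' (Multiset.mem_cons_of_mem hρ')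
      have h2 : r ≤ ‖z - ρ‖ := by
        simpa [dist_eq_norm, norm_sub_rev] using h ρ (Multiset.mem_cons_self _ _)
      have h3 : ‖w - z‖ < r := by simpa [dist_eq_norm] using hw
      have h4 : ‖w - ρ‖ ≤ 2 * ‖z - ρ‖ := by
        calc ‖w - ρ‖ = ‖(w - z) + (z - ρ)‖ := by ring_nf
          _ ≤ ‖w - z‖ + ‖z - ρ‖ := norm_add_le _ _
          _ ≤ 2 * ‖z - ρ‖ := by linarith
      simp only [Multiset.map_cons, Multiset.prod_cons, norm_mul, Multiset.card_cons]
      calc _ ≤ (2 * ‖z - ρ‖) * (2 ^ s.card * ‖(s.map fun ρ => z - ρ).prod‖) := by gcongr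
        _ = _ := by ring
  have hcard : p.roots.card ≤ N := (card_roots' p).trans hN
  have h := key p.roots fun ρ hρ hb => hp ρ hb (isRoot_of_mem_roots hρ)
  rw [hs.eval_eq_prod_roots, hs.eval_eq_prod_roots, norm_mul, norm_mul]
  calc _ ≤ ‖p.leadingCoeff‖ *
        (2 ^ p.roots.card * ‖(p.roots.map fun ρ => z - ρ).prod‖) := by gcongr
    _ ≤ ‖p.leadingCoeff‖ * (2 ^ N * ‖(p.roots.map fun ρ => z - ρ).prod‖) := by
        gcongr; norm_num
    _ = _ := by ring

/-- Hurwitz's theorem for polynomials of bounded degree. -/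
theorem eq_zero_or_isStable_of_tendsto {ι : Type*} {l : Filter ι} [l.NeBot] {P : ι → ℂ[X]}
    {q : ℂ[X]} {N : ℕ} (hN : ∀ i, (P i).natDegree ≤ N)
    (hP : ∀ᶠ i in l, P i = 0 ∨ IsStable (P i))
    (hlim : ∀ z, Tendsto (fun i => (P i).eval z) l (𝓝 (q.eval z))) :
    q = 0 ∨ IsStable q := by
  by_contra! hcon
  obtain ⟨hq, hstab⟩ := hcon
  simp only [IsStable, not_forall, not_not] at hstab
  obtain ⟨z, hz, hqz⟩ := hstab
  have hball : ∀ w ∈ Metric.ball z z.im, 0 < w.im := by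
    intro w hw
    have h1 : ‖w - z‖ < z.im := by simpa [dist_eq_norm] using hw
    have h2 := (abs_le.1 (Complex.abs_im_le_norm (w - z))).1
    rw [Complex.sub_im] at h2
    linarith
  -- a zero of `q` at `z` forces `q` to vanish on the whole disc of radius `Im z` about `z`
  have hzero : ∀ w ∈ Metric.ball z z.im, q.eval w = 0 := by
    intro w hw
    have hle : ‖q.eval w‖ ≤ 2 ^ N * ‖q.eval z‖ := by
      refine le_of_tendsto_of_tendsto (hlim w).norm ((hlim z).norm.const_mul _) ?_
      filter_upwards [hP] with i hi
      rcases hi with hi | hi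
      · simp [hi]
      · exact norm_eval_le_of_forall_mem_ball_eval_ne_zero (hN i)
          (fun y hy => hi y (hball y hy)) hw
    simpa [hqz] using hle
  refine hq (eq_zero_of_infinite_isRoot q (Set.Infinite.mono (fun w hw => hzero w hw) ?_))
  exact infinite_of_mem_nhds z (Metric.ball_mem_nhds z hz)

/-! ### The logarithmic derivative of a stable polynomial -/

theorem IsStable.im_inv_sub_neg {p : ℂ[X]} (hp : IsStable p) {y ρ : ℂ} (hy : 0 < y.im)
    (hρ : ρ ∈ p.roots) : (1 / (y - ρ)).im < 0 := by
  have hρ' : ρ.im ≤ 0 := by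
    by_contra! h
    exact hp ρ h (isRoot_of_mem_roots hρ)
  have him : 0 < (y - ρ).im := by rw [Complex.sub_im]; linarith
  have hne : y - ρ ≠ 0 := fun h => by simp [h] at him
  rw [one_div, Complex.inv_im]
  exact div_neg_of_neg_of_pos (by linarith) (Complex.normSq_pos.2 hne)

theorem IsStable.im_logDeriv_nonpos {p : ℂ[X]} (hp : IsStable p) {y : ℂ} (hy : 0 < y.im) :
    (p.derivative.eval y / p.eval y).im ≤ 0 := by
  rw [(IsAlgClosed.splits p).eval_derivative_div_eval_of_ne_zero (hp y hy),
    ← Complex.coe_imAddGroupHom, map_multiset_sum, Multiset.map_map]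
  refine (Multiset.sum_map_le_sum_map _ (fun _ => 0)
    fun ρ hρ => (hp.im_inv_sub_neg hy hρ).le).trans ?_
  simp

theorem IsStable.im_logDeriv_neg {p : ℂ[X]} (hp : IsStable p) (h0 : p.roots ≠ 0) {y : ℂ}
    (hy : 0 < y.im) : (p.derivative.eval y / p.eval y).im < 0 := by
  rw [(IsAlgClosed.splits p).eval_derivative_div_eval_of_ne_zero (hp y hy),
    ← Complex.coe_imAddGroupHom, map_multiset_sum, Multiset.map_map]
  refine (Multiset.sum_lt_sum_of_nonempty (f := _) (g := fun _ => 0) h0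
    fun ρ hρ => hp.im_inv_sub_neg hy hρ).trans_le ?_
  simp

/-- The upper half-plane case of the Gauss–Lucas theorem. -/
theorem IsStable.derivative {p : ℂ[X]} (hp : IsStable p) :
    derivative p = 0 ∨ IsStable (derivative p) := by
  by_cases h0 : p.roots = 0
  · left
    have hd : p.natDegree = 0 := by
      rw [(IsAlgClosed.splits p).natDegree_eq_card_roots, h0, Multiset.card_zero]
    rw [eq_C_of_natDegree_eq_zero hd, derivative_C]
  · right
    intro y hy h
    simpa [h] using hp.im_logDeriv_neg h0 hy

/-- A zero of `p + a p'` in the upper half-plane would give `p' / p = -1 / a` there, although the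
two sides have imaginary parts of different sign. -/
theorem IsStable.add_C_mul_derivative {p : ℂ[X]} (hp : IsStable p) {a : ℂ} (ha : 0 < a.im) :
    IsStable (p + C a * Polynomial.derivative p) := by
  intro y hy h
  have hne := hp y hy
  have ha0 : a ≠ 0 := fun h0 => by simp [h0] at ha
  have hval : p.derivative.eval y / p.eval y = -a⁻¹ := by
    simp only [eval_add, eval_mul, eval_C] at h
    field_simp
    linear_combination h
  have h1 := hp.im_logDeriv_nonpos hy
  rw [hval, Complex.neg_im, Complex.inv_im] at h1
  have h2 : 0 < a.im / Complex.normSq a := div_pos ha (Complex.normSq_pos.2 ha0)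
  rw [neg_div, neg_neg] at h1
  linarith

/-! ### The operators `f(xD)` -/

/-- The polynomial `f(xD) p = ∑ f⁽ᵏ⁾(0) / k! * x ^ k * p⁽ᵏ⁾`, where `D` is differentiation.
The sum may be cut off at the degree of `p`. -/
noncomputable def scaledDiffOp (f : ℂ → ℂ) (x : ℂ) (p : ℂ[X]) : ℂ[X] :=
  ∑ k ∈ Finset.range (p.natDegree + 1),
    C (iteratedDeriv k f 0 / (k.factorial : ℂ) * x ^ k) * (derivative^[k] p)

theorem scaledDiffOp_eq_sum_range (f : ℂ → ℂ) (x : ℂ) {p : ℂ[X]} {N : ℕ} (hN : p.natDegree ≤ N) :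
    scaledDiffOp f x p = ∑ k ∈ Finset.range (N + 1),
      C (iteratedDeriv k f 0 / (k.factorial : ℂ) * x ^ k) * (derivative^[k] p) := by
  refine Finset.sum_subset (by simpa using hN) fun k _ hk => ?_
  rw [iterate_derivative_eq_zero (by simpa using hk), mul_zero]

theorem natDegree_scaledDiffOp_le (f : ℂ → ℂ) (x : ℂ) (p : ℂ[X]) :
    (scaledDiffOp f x p).natDegree ≤ p.natDegree := by
  refine natDegree_sum_le_of_forall_le _ _ fun k _ => (natDegree_C_mul_le _ _).trans ?_
  exact (natDegree_iterate_derivative p k).trans (Nat.sub_le _ _)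

/-- The Leibniz rule makes `f ↦ f(xD)` multiplicative. -/
theorem scaledDiffOp_mul {f g : ℂ → ℂ} (hf : Differentiable ℂ f) (hg : Differentiable ℂ g)
    (x : ℂ) (p : ℂ[X]) :
    scaledDiffOp (f * g) x p = scaledDiffOp f x (scaledDiffOp g x p) := by
  set N := p.natDegree
  set a : ℕ → ℂ := fun k => iteratedDeriv k f 0 / (k.factorial : ℂ) * x ^ k with ha
  set b : ℕ → ℂ := fun k => iteratedDeriv k g 0 / (k.factorial : ℂ) * x ^ k with hb
  have hab : ∀ k, iteratedDeriv k (f * g) 0 / (k.factorial : ℂ) * x ^ k =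
      ∑ ij ∈ Finset.HasAntidiagonal.antidiagonal k, a ij.1 * b ij.2 := by
    intro k
    rw [iteratedDeriv_mul hf.contDiff.contDiffAt hg.contDiff.contDiffAt,
      Finset.Nat.sum_antidiagonal_eq_sum_range_succ (fun i j => a i * b j), Finset.sum_div,
      Finset.sum_mul]
    refine Finset.sum_congr rfl fun i hi => ?_
    have hik : i ≤ k := Nat.lt_succ_iff.1 (Finset.mem_range.1 hi)
    have hx : x ^ k = x ^ i * x ^ (k - i) := by rw [← pow_add, Nat.add_sub_cancel' hik]
    have h1 : (i.factorial : ℂ) ≠ 0 := mod_cast i.factorial_ne_zero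
    have h2 : ((k - i).factorial : ℂ) ≠ 0 := mod_cast (k - i).factorial_ne_zero
    have h3 : (k.factorial : ℂ) ≠ 0 := mod_cast k.factorial_ne_zero
    simp only [ha, hb]
    rw [Nat.cast_choose ℂ hik, hx]
    field_simp
  rw [scaledDiffOp_eq_sum_range f x (natDegree_scaledDiffOp_le g x p)]
  change ∑ k ∈ Finset.range (N + 1), C _ * derivative^[k] p =
    ∑ i ∈ Finset.range (N + 1), C (a i) *
      derivative^[i] (∑ j ∈ Finset.range (N + 1), C (b j) * derivative^[j] p)
  have hR : ∀ i, C (a i) *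
      derivative^[i] (∑ j ∈ Finset.range (N + 1), C (b j) * derivative^[j] p) =
      ∑ j ∈ Finset.range (N + 1), C (a i * b j) * derivative^[i + j] p := by
    intro i
    rw [iterate_derivative_sum, Finset.mul_sum]
    refine Finset.sum_congr rfl fun j _ => ?_
    rw [iterate_derivative_C_mul, ← mul_assoc, ← C_mul, Function.iterate_add_apply]
  simp only [hR, hab]
  rw [← Finset.sum_product' (f := fun i j => C (a i * b j) * derivative^[i + j] p)]
  have hL : ∀ k, C (∑ ij ∈ Finset.HasAntidiagonal.antidiagonal k, a ij.1 * b ij.2) *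
      derivative^[k] p = ∑ ij ∈ Finset.HasAntidiagonal.antidiagonal k,
        C (a ij.1 * b ij.2) * derivative^[ij.1 + ij.2] p := by
    intro k
    rw [map_sum, Finset.sum_mul]
    refine Finset.sum_congr rfl fun ij hij => ?_
    rw [Finset.HasAntidiagonal.mem_antidiagonal.1 hij]
  simp only [hL]
  -- the terms of the double sum off the triangle `i + j ≤ N` vanish
  rw [← Finset.sum_filter_add_sum_filter_not (Finset.range (N + 1) ×ˢ Finset.range (N + 1))
    (fun ij => ij.1 + ij.2 < N + 1)]
  rw [Finset.sum_eq_zero (s := Finset.filter (fun ij : ℕ × ℕ => ¬ ij.1 + ij.2 < N + 1) _), add_zero]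
  · rw [← Finset.sum_fiberwise_of_maps_to (t := Finset.range (N + 1))
      (g := fun ij : ℕ × ℕ => ij.1 + ij.2)]
    · refine Finset.sum_congr rfl fun k hk => Finset.sum_congr ?_ fun _ _ => rfl
      ext ⟨i, j⟩
      simp only [Finset.HasAntidiagonal.mem_antidiagonal, Finset.mem_filter, Finset.mem_product,
        Finset.mem_range] at hk ⊢
      omega
    · intro ij hij
      simpa using (Finset.mem_filter.1 hij).2
  · intro ij hij
    have h : ¬ ij.1 + ij.2 < N + 1 := (Finset.mem_filter.1 hij).2
    rw [iterate_derivative_eq_zero (show p.natDegree < ij.1 + ij.2 by omega), mul_zero]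

/-! ### Functions whose operators preserve stability -/

/-- For `x` in the upper half-plane, `f(xD)` maps stable polynomials to stable polynomials
or to `0`. -/
def PreservesStability (f : ℂ → ℂ) : Prop :=
  ∀ x : ℂ, 0 < x.im → ∀ p : ℂ[X], IsStable p →
    scaledDiffOp f x p = 0 ∨ IsStable (scaledDiffOp f x p)

theorem PreservesStability.mul {f g : ℂ → ℂ} (hf : Differentiable ℂ f) (hg : Differentiable ℂ g)
    (hf' : PreservesStability f) (hg' : PreservesStability g) : PreservesStability (f * g) := by
  intro x hx p hp
  rw [scaledDiffOp_mul hf hg]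
  rcases hg' x hx p hp with h | h
  · left
    rw [h]
    simp [scaledDiffOp]
  · exact hf' x hx _ h

theorem scaledDiffOp_affine (a b x : ℂ) (p : ℂ[X]) :
    scaledDiffOp (fun z => a + b * z) x p = C a * p + C (b * x) * derivative p := by
  have hd : ∀ k, iteratedDeriv (k + 1) (fun z : ℂ => a + b * z) 0 = if k = 0 then b else 0 := by
    intro k
    have h1 : deriv (fun z : ℂ => a + b * z) = fun _ => b := by
      ext z
      simp
    rw [iteratedDeriv_succ', h1, iteratedDeriv_const]
  rw [scaledDiffOp_eq_sum_range _ x (Nat.le_succ p.natDegree), Finset.sum_range_succ',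
    Finset.sum_range_succ']
  rw [Finset.sum_eq_zero fun k _ => by rw [hd (k + 1)]; simp]
  simp [hd 0, add_comm]

theorem PreservesStability.const (c : ℂ) : PreservesStability fun _ => c := by
  intro x _ p hp
  have h := scaledDiffOp_affine c 0 x p
  simp only [zero_mul, add_zero, map_zero] at h
  rw [h]
  by_cases hc : c = 0
  · simp [hc]
  · right
    intro y hy
    simpa [hc] using hp y hy

theorem PreservesStability.prod {ι : Type*} {f : ι → ℂ → ℂ} (s : Finset ι)
    (hf : ∀ i, Differentiable ℂ (f i)) (hf' : ∀ i, PreservesStability (f i)) :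
    PreservesStability (∏ i ∈ s, f i) := by
  classical
  induction s using Finset.induction_on with
  | empty => simpa using! PreservesStability.const 1
  | insert i s hi ih =>
    rw [Finset.prod_insert hi]
    exact (hf' i).mul (hf i) (Differentiable.finsetProd fun j _ => hf j) ih

theorem PreservesStability.id : PreservesStability fun z => z := by
  intro x hx p hp
  have h := scaledDiffOp_affine 0 1 x p
  simp only [zero_add, one_mul, map_zero, zero_mul] at h
  rw [h]
  have hx0 : x ≠ 0 := fun h0 => by simp [h0] at hx
  rcases hp.derivative with h | h
  · simp [h]
  · right
    intro y hy
    simpa [hx0] using h y hy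

theorem PreservesStability.one_add_mul {α : ℝ} (hα : 0 < α) :
    PreservesStability fun z => 1 + (α : ℂ) * z := by
  intro x hx p hp
  right
  rw [scaledDiffOp_affine, C_1, one_mul]
  refine hp.add_C_mul_derivative ?_
  rw [Complex.im_ofReal_mul]
  positivity

theorem PreservesStability.pow (m : ℕ) : PreservesStability fun z => z ^ m := by
  have h : (fun z : ℂ => z ^ m) = ∏ _i ∈ Finset.range m, fun z : ℂ => z := by
    ext z
    simp
  rw [h]
  exact .prod _ (fun _ => differentiable_id) (fun _ => .id)

/-- Taylor's formula: `exp (σxD)` is the translation by `σx`. -/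
theorem eval_scaledDiffOp_exp (σ x y : ℂ) (p : ℂ[X]) :
    (scaledDiffOp (fun z => Complex.exp (σ * z)) x p).eval y = p.eval (y + σ * x) := by
  have h : p.eval (y + σ * x) = (taylor y p).eval (σ * x) := by rw [taylor_eval, add_comm]
  rw [h, eval_eq_sum_range (p := taylor y p), natDegree_taylor, scaledDiffOp, eval_finsetSum]
  refine Finset.sum_congr rfl fun k _ => ?_
  have hk : (k.factorial : ℂ) ≠ 0 := mod_cast k.factorial_ne_zero
  have hd : (derivative^[k] p).eval y = k.factorial * (hasseDeriv k p).eval y := by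
    rw [← factorial_smul_hasseDeriv, LinearMap.smul_apply, eval_smul, nsmul_eq_mul]
  rw [taylor_coeff, iteratedDeriv_cexp_const_mul, eval_mul, eval_C, hd]
  simp only [mul_zero, Complex.exp_zero, mul_one]
  field_simp
  ring

theorem PreservesStability.exp {σ : ℝ} (hσ : 0 ≤ σ) :
    PreservesStability fun z => Complex.exp ((σ : ℂ) * z) := by
  intro x hx p hp
  right
  intro y hy
  rw [eval_scaledDiffOp_exp]
  refine hp _ ?_
  rw [Complex.add_im, Complex.im_ofReal_mul]
  positivity

theorem PreservesStability.comp_mul {f : ℂ → ℂ} (hf : Differentiable ℂ f)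
    (hf' : PreservesStability f) {t : ℝ} (ht : 0 ≤ t) :
    PreservesStability fun z => f (t * z) := by
  rcases ht.eq_or_lt with rfl | ht
  · simpa using PreservesStability.const (f 0)
  intro x hx p hp
  have h : scaledDiffOp (fun z => f (t * z)) x p = scaledDiffOp f (t * x) p := by
    refine Finset.sum_congr rfl fun k _ => ?_
    rw [iteratedDeriv_comp_const_mul hf.contDiff]
    beta_reduce
    rw [mul_zero]
    congr 2
    ring
  rw [h]
  refine hf' _ ?_ p hp
  rw [Complex.im_ofReal_mul]
  positivity

theorem PreservesStability.of_tendsto {ι : Type*} {l : Filter ι} [l.NeBot] {F : ι → ℂ → ℂ}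
    {f : ℂ → ℂ} (hF : ∀ i, PreservesStability (F i))
    (hlim : ∀ k, Tendsto (fun i => iteratedDeriv k (F i) 0) l (𝓝 (iteratedDeriv k f 0))) :
    PreservesStability f := by
  intro x hx p hp
  refine eq_zero_or_isStable_of_tendsto (l := l) (P := fun i => scaledDiffOp (F i) x p)
    (fun i => natDegree_scaledDiffOp_le _ _ _) (.of_forall fun i => hF i x hx p hp) fun z => ?_
  simp only [scaledDiffOp, eval_finsetSum, eval_mul, eval_C]
  refine tendsto_finsetSum _ fun k _ => ?_
  exact (((hlim k).div_const _).mul_const _).mul_const _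

/-! ### Functions with a product representation -/

theorem tendsto_iteratedDeriv_of_tendstoLocallyUniformlyOn {ι : Type*} {l : Filter ι}
    {U : Set ℂ} (hU : IsOpen U) {z : ℂ} (hz : z ∈ U) (k : ℕ) {F : ι → ℂ → ℂ} {f : ℂ → ℂ}
    (hF : ∀ i, DifferentiableOn ℂ (F i) U) (h : TendstoLocallyUniformlyOn F f l U) :
    Tendsto (fun i => iteratedDeriv k (F i) z) l (𝓝 (iteratedDeriv k f z)) := by
  induction k generalizing F f with
  | zero => simpa using h.tendsto_at hz
  | succ k ih =>
    simp only [iteratedDeriv_succ']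
    exact ih (fun i => (hF i).deriv hU) (h.deriv (.of_forall hF) hU)

section Product

variable {ι : Type*} {x : ι → ℝ}

theorem hasProdLocallyUniformlyOn_one_add_div (hx : ∀ k, 0 < x k)
    (hs : Summable fun k => 1 / x k) (R : ℝ) :
    HasProdLocallyUniformlyOn (fun k (z : ℂ) => 1 + z / (x k : ℂ))
      (fun z => ∏' k, (1 + z / (x k : ℂ))) (Metric.ball 0 R) := by
  refine Summable.hasProdLocallyUniformlyOn_one_add Metric.isOpen_ball (hs.mul_left R)
    (.of_forall fun k z hz => ?_) fun k => (continuous_id.div_const _).continuousOn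
  have hz' : ‖z‖ ≤ R := (mem_ball_zero_iff.1 hz).le
  rw [norm_div, Complex.norm_real, Real.norm_of_nonneg (hx k).le, mul_one_div]
  exact div_le_div_of_nonneg_right hz' (hx k).le

theorem differentiable_prod_one_add_div (s : Finset ι) :
    Differentiable ℂ fun z : ℂ => ∏ k ∈ s, (1 + z / (x k : ℂ)) := by
  fun_prop

theorem differentiable_tprod_one_add_div (hx : ∀ k, 0 < x k) (hs : Summable fun k => 1 / x k) :
    Differentiable ℂ fun z : ℂ => ∏' k, (1 + z / (x k : ℂ)) := by
  intro z
  have hz : z ∈ Metric.ball (0 : ℂ) (‖z‖ + 1) := by simp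
  have h := hasProdLocallyUniformlyOn_iff_tendstoLocallyUniformlyOn.1
    (hasProdLocallyUniformlyOn_one_add_div hx hs (‖z‖ + 1))
  refine (h.differentiableOn (.of_forall fun s => ?_) Metric.isOpen_ball).differentiableAt
    (Metric.isOpen_ball.mem_nhds hz)
  exact (differentiable_prod_one_add_div s).differentiableOn

theorem PreservesStability.tprod (hx : ∀ k, 0 < x k) (hs : Summable fun k => 1 / x k) :
    PreservesStability fun z : ℂ => ∏' k, (1 + z / (x k : ℂ)) := by
  have h := hasProdLocallyUniformlyOn_iff_tendstoLocallyUniformlyOn.1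
    (hasProdLocallyUniformlyOn_one_add_div hx hs 1)
  refine PreservesStability.of_tendsto (fun s => ?_)
    fun k => tendsto_iteratedDeriv_of_tendstoLocallyUniformlyOn Metric.isOpen_ball
      (Metric.mem_ball_self one_pos) k
      (fun s => (differentiable_prod_one_add_div s).differentiableOn) h
  have hprod : (fun z : ℂ => ∏ k ∈ s, (1 + z / (x k : ℂ))) =
      ∏ k ∈ s, fun z : ℂ => 1 + (((x k)⁻¹ : ℝ) : ℂ) * z := by
    ext z
    simp [div_eq_inv_mul]
  rw [hprod]
  exact .prod s (fun k => by fun_prop) (fun k => .one_add_mul (inv_pos.2 (hx k)))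

end Product

theorem HasTypeIRepresentation.preservesStability {f : ℂ → ℂ} (hf : HasTypeIRepresentation f) :
    PreservesStability f := by
  obtain ⟨c, m, σ, ω, x, hσ, hx, hs, h⟩ := hf
  have hfun : f = (((fun _ => (c : ℂ)) * fun z => z ^ m) * fun z => Complex.exp ((σ : ℂ) * z)) *
      fun z => ∏' k, (1 + z / (x k : ℂ)) := by
    ext z
    exact h z
  rw [hfun]
  have d1 : Differentiable ℂ fun _ : ℂ => (c : ℂ) := by fun_prop
  have d2 : Differentiable ℂ fun z : ℂ => z ^ m := by fun_prop
  have d3 : Differentiable ℂ fun z : ℂ => Complex.exp ((σ : ℂ) * z) := by fun_prop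
  exact (((PreservesStability.const c).mul d1 d2 (.pow m)).mul (d1.mul d2) d3 (.exp hσ)).mul
    ((d1.mul d2).mul d3) (differentiable_tprod_one_add_div hx hs) (.tprod hx hs)

/-! ### Taylor coefficients of real entire functions -/

theorem IsRealEntire.deriv {f : ℂ → ℂ} (hf : IsRealEntire f) : IsRealEntire (deriv f) := by
  refine ⟨hf.1.deriv, fun x => ?_⟩
  have h := ((hf.1 x).hasDerivAt.const_mul (-Complex.I)).real_of_complex
  have h0 : (fun y : ℝ => (-Complex.I * f y).re) = fun _ => 0 := by
    ext y
    simp [hf.2 y]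
  rw [h0] at h
  simpa using h.unique (hasDerivAt_const x (0 : ℝ))

theorem IsRealEntire.iteratedDeriv_zero {f : ℂ → ℂ} (hf : IsRealEntire f) (k : ℕ) :
    iteratedDeriv k f 0 = taylorCoeff f k := by
  have him : (iteratedDeriv k f 0).im = 0 := by
    induction k generalizing f with
    | zero => simpa using hf.2 0
    | succ k ih =>
      rw [iteratedDeriv_succ']
      exact ih hf.deriv
  exact Complex.ext (by simp [taylorCoeff]) (by simp [him])

theorem IsRealEntire.hasSum_taylorCoeff {f : ℂ → ℂ} (hf : IsRealEntire f) (x : ℝ) :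
    HasSum (fun k => taylorCoeff f k / (k.factorial : ℝ) * x ^ k) (f x).re := by
  have h := Complex.hasSum_re (Complex.hasSum_taylorSeries_of_entire hf.1 0 x)
  refine h.congr_fun fun k => ?_
  rw [hf.iteratedDeriv_zero, sub_zero, smul_eq_mul, smul_eq_mul, ← Complex.ofReal_pow,
    ← Complex.ofReal_natCast, ← Complex.ofReal_inv, ← Complex.ofReal_mul, ← Complex.ofReal_mul,
    Complex.ofReal_re]
  ring

theorem IsRealEntire.eq_zero_of_taylorCoeff_eq_zero {f : ℂ → ℂ} (hf : IsRealEntire f)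
    (h : ∀ k, taylorCoeff f k = 0) : f = fun _ => 0 := by
  ext z
  refine (Complex.hasSum_taylorSeries_of_entire hf.1 0 z).unique ?_
  simp [hf.iteratedDeriv_zero, h, hasSum_zero]

theorem IsLPPlus.taylorCoeff_div_factorial_mul_pow_le {f : ℂ → ℂ} (hf : IsLPPlus f) (k : ℕ) {x : ℝ}
    (hx : 0 ≤ x) : taylorCoeff f k / (k.factorial : ℝ) * x ^ k ≤ ‖f x‖ := by
  refine (le_hasSum (hf.1.1.hasSum_taylorCoeff x) k fun j _ => ?_).trans (Complex.re_le_norm _)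
  have := hf.2 j
  positivity

/-- If `f(-z)` rather than `f` has a product representation, then `f` is a monomial: a zero factor
would be a positive zero of `f`, and a factor `e ^ (-σz)` with `σ > 0` would make `f` decay
along the positive axis, and the nonnegative Taylor coefficients allow neither unless `f = 0`. -/
theorem IsLPPlus.exists_eq_mul_pow {f : ℂ → ℂ} (hf : IsLPPlus f)
    (hneg : HasTypeIRepresentation fun z => f (-z)) : ∃ (a : ℂ) (m : ℕ), f = fun z => a * z ^ m := by
  obtain ⟨c, m, σ, ω, x, hσ, hx, -, h⟩ := hneg
  have hzero : (∀ k, taylorCoeff f k = 0) → ∃ (a : ℂ) (m : ℕ), f = fun z => a * z ^ m :=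
    fun h0 => ⟨0, 0, by simpa using hf.1.1.eq_zero_of_taylorCoeff_eq_zero h0⟩
  rcases isEmpty_or_nonempty {k : ℕ // (k : ℕ∞) < ω} with hω | ⟨⟨j⟩⟩
  · have hval : ∀ z : ℂ, f z = c * (-z) ^ m * Complex.exp (-(σ * z)) := by
      intro z
      simpa using h (-z)
    rcases hσ.eq_or_lt with rfl | hσ
    · refine ⟨c * (-1) ^ m, m, ?_⟩
      ext z
      rw [hval, neg_pow]
      simp [mul_assoc]
    refine hzero fun k => le_antisymm (not_lt.1 fun hpos => ?_) (hf.2 k)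
    have hlim : Tendsto (fun y : ℝ => |c| * (y ^ (m : ℝ) * Real.exp (-σ * y))) atTop (𝓝 0) := by
      simpa using (tendsto_rpow_mul_exp_neg_mul_atTop_nhds_zero m σ hσ).const_mul |c|
    have hle : taylorCoeff f k / (k.factorial : ℝ) ≤ 0 := by
      refine ge_of_tendsto hlim ?_
      filter_upwards [eventually_ge_atTop 1] with y hy
      have hy0 : 0 ≤ y := zero_le_one.trans hy
      have h1 := hf.taylorCoeff_div_factorial_mul_pow_le k hy0
      have h2 : ‖f y‖ = |c| * (y ^ (m : ℝ) * Real.exp (-σ * y)) := by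
        rw [hval, norm_mul, norm_mul, norm_pow, norm_neg, Complex.norm_real, Complex.norm_real,
          Complex.norm_exp, Real.norm_eq_abs, Real.norm_of_nonneg hy0, Real.rpow_natCast, mul_assoc]
        simp
      rw [← h2]
      refine le_trans (le_mul_of_one_le_right ?_ (one_le_pow₀ hy)) h1
      positivity
    exact hle.not_gt (by positivity)
  · have hj : f (x j) = 0 := by
      have h1 := h (-(x j : ℂ))
      beta_reduce at h1
      rw [neg_neg] at h1
      have hj0 : (x j : ℂ) ≠ 0 := mod_cast (hx j).ne'
      have h2 : ∏' k, (1 + -(x j : ℂ) / (x k : ℂ)) = 0 :=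
        tprod_of_exists_eq_zero ⟨j, by rw [neg_div, div_self hj0, add_neg_cancel]⟩
      rw [h1, h2, mul_zero]
    refine hzero fun k => le_antisymm (not_lt.1 fun hpos => ?_) (hf.2 k)
    have h1 := hf.taylorCoeff_div_factorial_mul_pow_le k (hx j).le
    rw [hj, norm_zero] at h1
    have hxj := hx j
    exact h1.not_gt (by positivity)

theorem IsLPPlus.preservesStability {f : ℂ → ℂ} (hf : IsLPPlus f) : PreservesStability f := by
  rcases hf.1.2 with h | h
  · exact h.preservesStability
  · obtain ⟨a, m, rfl⟩ := hf.exists_eq_mul_pow h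
    exact (PreservesStability.const a).mul (by fun_prop) (by fun_prop) (.pow m)

/-! ### Multiplier sequences -/

theorem coeff_diagonalOperator (γ : ℕ → ℝ) (p : ℝ[X]) (k : ℕ) :
    (diagonalOperator γ p).coeff k = γ k * p.coeff k := by
  induction p using Polynomial.induction_on' with
  | add p q hp hq => simp [hp, hq, mul_add]
  | monomial n a =>
    rw [← mul_one a, ← smul_eq_mul, ← smul_monomial, monomial_one_right_eq_X_pow, map_smul,
      diagonalOperator_X_pow]
    simp only [coeff_smul, coeff_X_pow, smul_eq_mul]
    split_ifs with h
    · subst h; ring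
    · simp

theorem numNonrealZeros_eq_zero_iff (p : ℝ[X]) :
    numNonrealZeros p = 0 ↔ ∀ z ∈ (p.map (algebraMap ℝ ℂ)).roots, z.im = 0 := by
  simp [numNonrealZeros, Multiset.filter_eq_nil]

/-- The zeros of a real polynomial are symmetric about the real axis. -/
theorem numNonrealZeros_eq_zero_of_isStable {p : ℝ[X]} (hp : IsStable (p.map (algebraMap ℝ ℂ))) :
    numNonrealZeros p = 0 := by
  refine (numNonrealZeros_eq_zero_iff p).2 fun z hz => ?_
  have hz0 : aeval z p = 0 := by simpa [aeval_def, eval_map] using isRoot_of_mem_roots hz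
  refine le_antisymm ?_ ?_
  · by_contra! h
    exact hp z h (isRoot_of_mem_roots hz)
  · by_contra! h
    refine hp ((starRingEnd ℂ) z) (by simpa using h) ?_
    rw [eval_map_algebraMap, aeval_conj, hz0, map_zero]

/-- The vanishing of `f(xD) p` does not depend on the point `x ≠ 0`. -/
theorem iteratedDeriv_eq_zero_of_scaledDiffOp_eq_zero {f : ℂ → ℂ} {x : ℂ} (hx : x ≠ 0) {p : ℂ[X]}
    (hp : p ≠ 0) (h : scaledDiffOp f x p = 0) {k : ℕ} (hk : k ≤ p.natDegree) :
    iteratedDeriv k f 0 = 0 := by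
  induction k using Nat.strong_induction_on with
  | _ k ih =>
    -- only the `k`-th term of `f(xD) p` contributes to degree `natDegree p - k`
    have hc := congrArg (fun q : ℂ[X] => q.coeff (p.natDegree - k)) h
    simp only [scaledDiffOp, finsetSum_coeff, coeff_C_mul, coeff_zero] at hc
    rw [Finset.sum_eq_single_of_mem k (by simpa [Nat.lt_succ_iff] using hk)] at hc
    · rw [coeff_iterate_derivative, Nat.sub_add_cancel hk, coeff_natDegree, nsmul_eq_mul] at hc
      have h1 : (p.natDegree.descFactorial k : ℂ) ≠ 0 := by
        rw [Nat.cast_ne_zero, Ne, Nat.descFactorial_eq_zero_iff_lt]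
        omega
      have h2 : (k.factorial : ℂ) ≠ 0 := mod_cast k.factorial_ne_zero
      simpa [h1, h2, hx, hp] using hc
    · intro j hj hjk
      have hj' : j ≤ p.natDegree := by simpa [Nat.lt_succ_iff] using hj
      rcases lt_or_gt_of_ne hjk with hlt | hgt
      · simp [ih j hlt hj']
      · rw [coeff_eq_zero_of_natDegree_lt, mul_zero]
        have := natDegree_iterate_derivative p j
        omega

/-- The polynomial `T[p](x) = ∑ γ k * a k * x ^ k` is the value of `f(xD) p` at `y = 0`, hence the
limit, as `y` tends to `0` in the upper half-plane, of polynomials in `x` that are stable. -/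
theorem PreservesStability.isMultiplierSequence {f : ℂ → ℂ} (hf : PreservesStability f)
    {γ : ℕ → ℝ} (hγ : ∀ k, iteratedDeriv k f 0 = γ k) : IsMultiplierSequence γ := by
  intro p hp
  rcases eq_or_ne p 0 with rfl | hp0
  · simpa using hp
  set P : ℂ[X] := p.map (algebraMap ℝ ℂ) with hP
  set N := P.natDegree with hN
  have hP0 : P ≠ 0 := by simpa [hP] using hp0
  have hPs : IsStable P := fun y hy h =>
    hy.ne' ((numNonrealZeros_eq_zero_iff p).1 hp y ((mem_roots hP0).2 h))
  have hcoeff : ∀ k, ((diagonalOperator γ p).map (algebraMap ℝ ℂ)).coeff k =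
      γ k * P.coeff k := by
    intro k
    simp [hP, coeff_diagonalOperator]
  by_cases hall : ∀ k ≤ N, γ k = 0
  · have hq : (diagonalOperator γ p).map (algebraMap ℝ ℂ) = 0 := by
      ext k
      rw [hcoeff]
      rcases le_or_gt k N with hk | hk
      · simp [hall k hk]
      · simp [coeff_eq_zero_of_natDegree_lt hk]
    exact (numNonrealZeros_eq_zero_iff _).2 (by simp [hq])
  push Not at hall
  obtain ⟨k₀, hk₀, hγk₀⟩ := hall
  let G : ℂ → ℂ[X] := fun y => ∑ k ∈ Finset.range (N + 1),
    C (γ k / (k.factorial : ℂ) * (derivative^[k] P).eval y) * X ^ k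
  have hGeval : ∀ y x, (G y).eval x = (scaledDiffOp f x P).eval y := by
    intro y x
    simp only [G, scaledDiffOp, eval_finsetSum, eval_mul, eval_C, eval_pow, eval_X, hγ]
    exact Finset.sum_congr rfl fun k _ => by ring
  have hGstable : ∀ y : ℂ, 0 < y.im → IsStable (G y) := by
    intro y hy x hx
    rw [hGeval]
    have hx0 : x ≠ 0 := fun h0 => by simp [h0] at hx
    rcases hf x hx P hPs with h | h
    · have h1 := iteratedDeriv_eq_zero_of_scaledDiffOp_eq_zero hx0 hP0 h hk₀
      rw [hγ] at h1
      exact absurd (mod_cast h1) hγk₀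
    · exact h y hy
  have hy : Tendsto (fun n : ℕ => ((1 / ((n : ℝ) + 1) : ℝ) : ℂ) * Complex.I) atTop (𝓝 0) := by
    have h := (Complex.continuous_ofReal.tendsto 0).comp
      (tendsto_one_div_add_atTop_nhds_zero_nat (𝕜 := ℝ))
    simpa using h.mul_const Complex.I
  have hlim := eq_zero_or_isStable_of_tendsto (l := atTop) (N := N)
    (P := fun n : ℕ => G (((1 / ((n : ℝ) + 1) : ℝ) : ℂ) * Complex.I))
    (q := (diagonalOperator γ p).map (algebraMap ℝ ℂ)) ?_ ?_ ?_
  · rcases hlim with h | h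
    · exact (numNonrealZeros_eq_zero_iff _).2 (by simp [h])
    · exact numNonrealZeros_eq_zero_of_isStable h
  · intro n
    refine natDegree_sum_le_of_forall_le _ _ fun k hk => (natDegree_C_mul_X_pow_le _ _).trans ?_
    simpa [Nat.lt_succ_iff] using hk
  · refine .of_forall fun n => Or.inr (hGstable _ ?_)
    rw [Complex.im_ofReal_mul, Complex.I_im]
    positivity
  · intro z
    have hdeg : ((diagonalOperator γ p).map (algebraMap ℝ ℂ)).natDegree < N + 1 := by
      refine Nat.lt_succ_of_le (natDegree_le_iff_coeff_eq_zero.2 fun k hk => ?_)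
      rw [hcoeff, coeff_eq_zero_of_natDegree_lt hk, mul_zero]
    rw [eval_eq_sum_range' hdeg]
    simp only [G, eval_finsetSum, eval_mul, eval_C, eval_pow, eval_X]
    refine tendsto_finsetSum _ fun k _ => Tendsto.mul_const _ ?_
    have hk : (k.factorial : ℂ) ≠ 0 := mod_cast k.factorial_ne_zero
    have h0 : γ k * P.coeff k = γ k / (k.factorial : ℂ) * (derivative^[k] P).eval 0 := by
      rw [← coeff_zero_eq_eval_zero, coeff_iterate_derivative, zero_add, Nat.descFactorial_self,
        nsmul_eq_mul]
      field_simp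
    rw [hcoeff, h0]
    exact (((derivative^[k] P).continuous.tendsto 0).comp hy).const_mul _

/-! ### The sequences `B` and `C` as Taylor coefficients -/

theorem iteratedDeriv_exp_mul_comp_mul {φ : ℂ → ℂ} (hφ : IsRealEntire φ) (t : ℝ) (k : ℕ) :
    iteratedDeriv k ((fun z : ℂ => Complex.exp (((1 - t : ℝ) : ℂ) * z)) *
      fun z => φ (t * z)) 0 = seqB φ t k := by
  have hd : Differentiable ℂ φ := hφ.1
  have h1 : Differentiable ℂ fun z : ℂ => Complex.exp (((1 - t : ℝ) : ℂ) * z) := by fun_prop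
  have h2 : Differentiable ℂ fun z : ℂ => φ (t * z) := by fun_prop
  rw [iteratedDeriv_mul h1.contDiff.contDiffAt h2.contDiff.contDiffAt, seqB, Complex.ofReal_sum]
  refine Finset.sum_congr rfl fun j _ => ?_
  rw [iteratedDeriv_cexp_const_mul, iteratedDeriv_comp_const_mul hd.contDiff]
  beta_reduce
  rw [mul_zero, mul_zero, Complex.exp_zero, hφ.iteratedDeriv_zero]
  push_cast
  ring

end LaguerrePolya

open LaguerrePolya in
theorem mainTheorem9 (φ Φ : ℂ → ℂ)
    (hφ : LaguerrePolya.IsLPPlus φ) (hΦ : LaguerrePolya.IsLPPlus Φ)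
    (t s : ℝ) (ht : t ∈ Set.Icc (0 : ℝ) 1) (hs : s ∈ Set.Icc (0 : ℝ) 1) :
    LaguerrePolya.IsMultiplierSequence (LaguerrePolya.seqC φ Φ t s) ∧
    ∀ x : ℂ,
      HasSum (fun k : ℕ => (LaguerrePolya.seqC φ Φ t s k : ℂ) / (Nat.factorial k : ℂ) * x ^ k)
        (Complex.exp (((1 - (t : ℂ)) + (1 - (s : ℂ))) * x) *
          φ (x * (t : ℂ)) * Φ (x * (s : ℂ))) := by
  -- `E ψ r` is the function `e ^ ((1 - r) z) ψ(rz)`, whose Taylor coefficients are `seqB ψ r`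
  let E : (ℂ → ℂ) → ℝ → ℂ → ℂ := fun ψ r =>
    (fun z : ℂ => Complex.exp (((1 - r : ℝ) : ℂ) * z)) * fun z => ψ (r * z)
  have hE : ∀ ψ r, IsLPPlus ψ → Differentiable ℂ (E ψ r) := by
    intro ψ r hψ
    have hd : Differentiable ℂ ψ := hψ.1.1.1
    have h1 : Differentiable ℂ fun z : ℂ => Complex.exp (((1 - r : ℝ) : ℂ) * z) := by fun_prop
    have h2 : Differentiable ℂ fun z : ℂ => ψ (r * z) := by fun_prop
    exact h1.mul h2
  have hE' : ∀ ψ r, IsLPPlus ψ → r ∈ Set.Icc (0 : ℝ) 1 → PreservesStability (E ψ r) := by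
    intro ψ r hψ hr
    have hd : Differentiable ℂ ψ := hψ.1.1.1
    exact (PreservesStability.exp (sub_nonneg.2 hr.2)).mul (by fun_prop) (by fun_prop)
      (hψ.preservesStability.comp_mul hd hr.1)
  have hC : ∀ k, iteratedDeriv k (E φ t * E Φ s) 0 = seqC φ Φ t s k := by
    intro k
    rw [iteratedDeriv_mul (hE φ t hφ).contDiff.contDiffAt (hE Φ s hΦ).contDiff.contDiffAt, seqC,
      Complex.ofReal_sum]
    refine Finset.sum_congr rfl fun j _ => ?_
    simp only [E, iteratedDeriv_exp_mul_comp_mul hφ.1.1, iteratedDeriv_exp_mul_comp_mul hΦ.1.1]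
    push_cast
    ring
  refine ⟨((hE' φ t hφ ht).mul (hE φ t hφ) (hE Φ s hΦ) (hE' Φ s hΦ hs)).isMultiplierSequence hC,
    fun x => ?_⟩
  have h := Complex.hasSum_taylorSeries_of_entire ((hE φ t hφ).mul (hE Φ s hΦ)) 0 x
  have hval : (E φ t * E Φ s) x = Complex.exp (((1 - (t : ℂ)) + (1 - (s : ℂ))) * x) *
      φ (x * (t : ℂ)) * Φ (x * (s : ℂ)) := by
    simp only [E, Pi.mul_apply, add_mul, Complex.exp_add, Complex.ofReal_sub, Complex.ofReal_one,
      mul_comm x]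
    ring
  rw [hval] at h
  refine h.congr_fun fun k => ?_
  rw [hC, sub_zero, smul_eq_mul, smul_eq_mul, div_eq_mul_inv]
  ring
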